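/- A convergent power series $\hat\varphi\in\mathbb C\{\zeta\}$ is *endlessly continuable* if for every real $L>0$ there is a finite set $F_L\subset\mathbb C$ such that $\hat\varphi$ can be analytically continued along every Lipschitz path $\gamma:[0,1]\to\mathbb C$ of length $<L$ with $\gamma(0)=0$ and $\gamma((0,1])\subset\mathbb C\setminus F_L$. Let $\hat{\mathscr R}$ be the set of these series. A *discrete filtered set* is a family $\Omega=(\Omega_L)_{L\in\mathbb R_{\ge0}}$ of finite subsets of $\mathbb C$ such that $\Omega_{L_1}\subseteq\Omega_{L_2}$ whenever $L_1\le L_2$, and $\Omega_\delta=\emptyset$ for some $\delta>0$. Let $\mathcal S_\Omega=\{(\lambda,\omega)\in\mathbb R_{\ge0}\times\mathbb C : \omega\in\Omega_\lambda\}$ and let $\mathcal M_\Omega=(\mathbb R_{\ge0}\times\mathbb C)\setminus\overline{\mathcal S_\Omega}$, the closure being taken in $\mathbb R_{\ge0}\times\mathbb C$. A Lipschitz path $\gamma:[0,t_*]\to\mathbb C$ with $t_*\ge0$ and $\gamma(0)=0$ is *$\Omega$-allowed* if $(L(\gamma|_{[0,t]}),\gamma(t))\in\mathcal M_\Omega$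 for all $t\in[0,t_*]$, where $L(\cdot)$ denotes the length. A convergent power series is *$\Omega$-continuable* if it can be analytically continued along every $\Omega$-allowed path. Let $\hat{\mathscr R}_\Omega$ be the set of these series. For a formal series $\tilde\varphi=\sum_{j\ge0}\varphi_jz^j\in\mathbb C[[z]]$ put $\hat\varphi(\zeta)=\sum_{j\ge1}\varphi_j\,\zeta^{j-1}/(j-1)!$ (the formal Borel transform of $\tilde\varphi-\varphi_0$). The series $\tilde\varphi$ is *resurgent* if $\hat\varphi\in\hat{\mathscr R}$, and *$\Omega$-resurgent* if $\hat\varphi\in\hat{\mathscr R}_\Omega$. **Proposition.** A formal series $\tilde\varphi\in\mathbb C[[z]]$ is resurgent if and only if there exists a discrete filtered set $\Omega$ such that $\tilde\varphi$ is $\Omega$-resurgent. Correspondingly, $$\hat{\mathscr R}=\bigcup_{\Omega}\hat{\mathscr R}_\Omega,$$ where $\Omega$ runs over all discrete filtered sets. -/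

import Mathlib

open Set Filter Topology
open scoped NNReal ENNReal PowerSeries

noncomputable section

namespace Resurgence

/-- The power series `φ` viewed as a Mathlib formal multilinear series `∑ φₙ ζⁿ` on `ℂ`. -/
def toFMS (φ : ℂ⟦X⟧) : FormalMultilinearSeries ℂ ℂ ℂ :=
  FormalMultilinearSeries.ofScalars ℂ (fun n => PowerSeries.coeff n φ)

/-- `φ ∈ ℂ{ζ}`: the radius of convergence is positive. -/
def IsConvergent (φ : ℂ⟦X⟧) : Prop := 0 < (toFMS φ).radius

/-- The sum of `φ`, meaningful on the disc of convergence. -/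
def evalSum (φ : ℂ⟦X⟧) : ℂ → ℂ := (toFMS φ).sum

/-- A Lipschitz path `γ : [0, T] → ℂ` with `T ≥ 0` and `γ 0 = 0`. The values of `toFun` outside
`[0, T]` are irrelevant. -/
structure LipPath where
  T : ℝ
  T_nonneg : 0 ≤ T
  toFun : ℝ → ℂ
  lipschitz : ∃ K : ℝ≥0, LipschitzOnWith K toFun (Icc 0 T)
  map_zero : toFun 0 = 0

/-- The length of the restriction of `γ` to `[0, t]`, for `t ∈ [0, T]`
(finite, since `γ` is Lipschitz). -/
def LipPath.lengthUpTo (γ : LipPath) (t : ℝ) : ℝ≥0 :=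
  (eVariationOn γ.toFun (Icc 0 t)).toNNReal

/-- The total length of `γ`. -/
def LipPath.length (γ : LipPath) : ℝ≥0 := γ.lengthUpTo γ.T

/-- The germ at `0` defined by `φ` can be analytically continued along `γ`: there are germs `F t` of
analytic functions at `γ t`, starting with `φ`, such that for `s` close to `t` the germ `F s`
is the one induced by `F t` at `γ s`. -/
def ContinuableAlong (φ : ℂ⟦X⟧) (γ : LipPath) : Prop :=
  ∃ F : ℝ → ℂ → ℂ,
    (∀ t ∈ Icc 0 γ.T, AnalyticAt ℂ (F t) (γ.toFun t)) ∧
    F 0 =ᶠ[𝓝 0] evalSum φ ∧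
    ∀ t ∈ Icc 0 γ.T, ∀ᶠ s in 𝓝[Icc 0 γ.T] t, F s =ᶠ[𝓝 (γ.toFun s)] F t

/-- Endlessly continuable functions. -/
def EndlesslyContinuable : Set ℂ⟦X⟧ :=
  {φ | IsConvergent φ ∧
    ∀ L : ℝ, 0 < L → ∃ F : Set ℂ, F.Finite ∧
      ∀ γ : LipPath, γ.T = 1 → (γ.length : ℝ) < L →
        (∀ t ∈ Ioc (0 : ℝ) 1, γ.toFun t ∉ F) → ContinuableAlong φ γ}

/-- Discrete filtered sets. -/
structure DiscreteFilteredSet where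
  carrier : ℝ≥0 → Set ℂ
  finite : ∀ L, (carrier L).Finite
  mono : ∀ L₁ L₂, L₁ ≤ L₂ → carrier L₁ ⊆ carrier L₂
  exists_empty : ∃ δ : ℝ≥0, 0 < δ ∧ carrier δ = ∅

/-- The set of all `(l, ω)` with `ω ∈ Ω_l`, as a subset of `ℝ≥0 × ℂ`. -/
def DiscreteFilteredSet.graph (Ω : DiscreteFilteredSet) : Set (ℝ≥0 × ℂ) :=
  {p | p.2 ∈ Ω.carrier p.1}

/-- The allowed open set: the complement in `ℝ≥0 × ℂ` of the closure of `graph`. -/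
def DiscreteFilteredSet.allowed (Ω : DiscreteFilteredSet) : Set (ℝ≥0 × ℂ) :=
  (closure Ω.graph)ᶜ

/-- `Ω`-allowed paths. -/
def DiscreteFilteredSet.AllowedPath (Ω : DiscreteFilteredSet) (γ : LipPath) : Prop :=
  ∀ t ∈ Icc 0 γ.T, (γ.lengthUpTo t, γ.toFun t) ∈ Ω.allowed

/-- `Ω`-continuable functions. -/
def Continuable (Ω : DiscreteFilteredSet) : Set ℂ⟦X⟧ :=
  {φ | IsConvergent φ ∧ ∀ γ : LipPath, Ω.AllowedPath γ → ContinuableAlong φ γ}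

/-- The formal Borel transform; the pair `(c, ψ)` stands for `c δ + ψ` in `ℂ δ ⊕ ℂ⟦ζ⟧`. -/
def borelTransform (φ : ℂ⟦X⟧) : ℂ × ℂ⟦X⟧ :=
  (PowerSeries.coeff 0 φ, PowerSeries.mk fun j => PowerSeries.coeff (j + 1) φ / (Nat.factorial j : ℂ))

/-- Resurgent series. -/
def Resurgent : Set ℂ⟦X⟧ := borelTransform ⁻¹' (univ ×ˢ EndlesslyContinuable)

/-- `Ω`-resurgent series. -/
def ResurgentFor (Ω : DiscreteFilteredSet) : Set ℂ⟦X⟧ := borelTransform ⁻¹' (univ ×ˢ Continuable Ω)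

end Resurgence

end

/-!
An `Ω`-allowed path is one along which `γ t` never lies in (the closure of) `Ω_L` for `L` the length
travelled so far; in particular paths of length `< L` avoiding `Ω_L` after time `0` are `Ω`-allowed,
and `F_L = Ω_L` shows that every `Ω`-continuable series is endlessly continuable.

Conversely, let the finite set `S k` be adapted to paths of length `< k + 1`, let `φ` be analytic on
the disc of radius `δ`, and put `Ω_L = S 0 ∪ ⋯ ∪ S ⌊L⌋` for `L ≥ δ` and `Ω_L = ∅` for `L < δ`. Let
`γ` be `Ω`-allowed and suppose that `φ` has been continued up to a time `s`. If the length travelled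
is `< δ`, we are still in the disc. Otherwise `γ s ∉ S k`, where `k` is the integer part of that
length, but `γ` may have met `S k` earlier. Add to `γ` a small constant velocity: for almost every
choice the new path avoids `S k`, and a small perturbation of the path does not change the germs.
Prolonging the new path by segments, we see that the germ at `γ s` extends to a disc centred at
`γ s` whose radius depends only on the distance to `S k` and on the length left before `k + 1`.
Hence continuation never stops.
-/

namespace Resurgence

section GermContinuation

variable {E F X Y : Type*} [NormedAddCommGroup E] [NormedSpace ℂ E] [NormedAddCommGroup F]
  [NormedSpace ℂ F] [TopologicalSpace X] [TopologicalSpace Y]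

theorem eventuallyEq_of_analyticOnNhd_ball_inter {f g : E → F} {p q x y : E} {r s : ℝ}
    (hf : AnalyticOnNhd ℂ f (Metric.ball p r)) (hg : AnalyticOnNhd ℂ g (Metric.ball q s))
    (hx : x ∈ Metric.ball p r ∩ Metric.ball q s) (hy : y ∈ Metric.ball p r ∩ Metric.ball q s)
    (h : f =ᶠ[𝓝 x] g) : f =ᶠ[𝓝 y] g :=
  have heq : EqOn f g (Metric.ball p r ∩ Metric.ball q s) :=
    (hf.mono inter_subset_left).eqOn_of_preconnected_of_eventuallyEq (hg.mono inter_subset_right)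
      ((convex_ball p r).inter (convex_ball q s)).isPreconnected hx h
  heq.eventuallyEq_of_mem ((Metric.isOpen_ball.inter Metric.isOpen_ball).mem_nhds hy)

/-- Analytic continuation along the restriction to `I` of a path `c`: a family of germs `G t` at the
points `c t`, each of which induces the neighbouring ones. A germ is encoded by a function, of which
only the values near the base point matter. -/
structure IsGermContinuation (c : X → E) (I : Set X) (G : X → E → F) : Prop where
  analyticAt : ∀ t ∈ I, AnalyticAt ℂ (G t) (c t)
  eventually_eq : ∀ t ∈ I, ∀ᶠ s in 𝓝[I] t, G s =ᶠ[𝓝 (c s)] G t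

namespace IsGermContinuation

variable {c c' : X → E} {I J : Set X} {G H : X → E → F}

theorem const {g : E → F} (hg : ∀ t ∈ I, AnalyticAt ℂ g (c t)) :
    IsGermContinuation c I fun _ => g :=
  ⟨hg, fun _ _ => Eventually.of_forall fun _ => EventuallyEq.rfl⟩

theorem comp {d : Y → E} {K : Set Y} {u : Y → X} (h : IsGermContinuation c I G)
    (hu : ContinuousOn u K) (hKI : MapsTo u K I) (hd : EqOn (c ∘ u) d K) :
    IsGermContinuation d K (G ∘ u) where
  analyticAt t ht := hd ht ▸ h.analyticAt (u t) (hKI ht)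
  eventually_eq t ht := by
    have hmem : ∀ᶠ s in 𝓝[K] t, s ∈ K := self_mem_nhdsWithin
    filter_upwards [((hu t ht).tendsto_nhdsWithin hKI).eventually
      (h.eventually_eq (u t) (hKI ht)), hmem] with s hs hsK
    exact hd hsK ▸ hs

theorem mono (h : IsGermContinuation c I G) (hJ : J ⊆ I) : IsGermContinuation c J G :=
  h.comp continuousOn_id hJ fun _ _ => rfl

theorem congr_path (h : IsGermContinuation c I G) (hc : EqOn c c' I) :
    IsGermContinuation c' I G :=
  h.comp continuousOn_id (mapsTo_id I) hc

theorem congr (hc : ContinuousOn c I) (h : IsGermContinuation c I G)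
    (hGH : ∀ t ∈ I, G t =ᶠ[𝓝 (c t)] H t) : IsGermContinuation c I H where
  analyticAt t ht := (h.analyticAt t ht).congr (hGH t ht)
  eventually_eq t ht := by
    have hmem : ∀ᶠ s in 𝓝[I] t, s ∈ I := self_mem_nhdsWithin
    filter_upwards [h.eventually_eq t ht, hmem,
      (hc t ht).eventually (eventually_eventually_nhds.2 (hGH t ht))] with s hs hsI hst
    exact ((hGH s hsI).symm.trans hs).trans hst

theorem union (hI : IsClosed I) (hJ : IsClosed J) (hGI : IsGermContinuation c I G)
    (hGJ : IsGermContinuation c J G) : IsGermContinuation c (I ∪ J) G := by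
  have key {K : Set X} (hK : IsClosed K) (hGK : IsGermContinuation c K G) (t : X) :
      ∀ᶠ s in 𝓝[K] t, G s =ᶠ[𝓝 (c s)] G t := by
    by_cases ht : t ∈ K
    · exact hGK.eventually_eq t ht
    · simp only [(notMem_closure_iff_nhdsWithin_eq_bot).1 (hK.closure_eq.symm ▸ ht),
        eventually_bot]
  refine ⟨fun t ht => ht.elim (hGI.analyticAt t) (hGJ.analyticAt t), fun t _ => ?_⟩
  rw [nhdsWithin_union]
  exact eventually_sup.2 ⟨key hI hGI t, key hJ hGJ t⟩

theorem concat [LinearOrder X] [OrderClosedTopology X] {x y z : X} (hc : ContinuousOn c (Icc y z))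
    (hxy : x ≤ y) (hyz : y ≤ z) (hG : IsGermContinuation c (Icc x y) G)
    (hH : IsGermContinuation c (Icc y z) H) (h : G y =ᶠ[𝓝 (c y)] H y) :
    IsGermContinuation c (Icc x z) fun t => if t ≤ y then G t else H t := by
  rw [← Icc_union_Icc_eq_Icc hxy hyz]
  refine union isClosed_Icc isClosed_Icc ⟨fun t ht => ?_, fun t ht => ?_⟩ (hH.congr hc ?_)
  · simpa only [if_pos ht.2] using hG.analyticAt t ht
  · have hmem : ∀ᶠ s in 𝓝[Icc x y] t, s ∈ Icc x y := self_mem_nhdsWithin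
    filter_upwards [hG.eventually_eq t ht, hmem] with s hs hsI
    simpa only [if_pos ht.2, if_pos hsI.2] using hs
  · intro t ht
    rcases ht.1.eq_or_lt with rfl | hlt
    · simpa only [le_refl, if_true] using h.symm
    · simp only [if_neg hlt.not_ge, EventuallyEq.rfl]

theorem of_dist_lt {r : ℝ} (hc : ContinuousOn c I) (hc' : ContinuousOn c' I)
    (h : IsGermContinuation c I G) (hG : ∀ t ∈ I, AnalyticOnNhd ℂ (G t) (Metric.ball (c t) r))
    (hcc' : ∀ t ∈ I, dist (c' t) (c t) < r) : IsGermContinuation c' I G where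
  analyticAt t ht := hG t ht _ (hcc' t ht)
  eventually_eq t ht := by
    have hr : 0 < r := dist_nonneg.trans_lt (hcc' t ht)
    have hmem : ∀ᶠ s in 𝓝[I] t, s ∈ I := self_mem_nhdsWithin
    filter_upwards [h.eventually_eq t ht, hmem,
      (hc t ht).eventually (Metric.ball_mem_nhds (c t) hr),
      (hc' t ht).eventually (Metric.isOpen_ball.mem_nhds (hcc' t ht))] with s hs hsI hcs hcs'
    exact eventuallyEq_of_analyticOnNhd_ball_inter (hG s hsI) (hG t ht)
      ⟨Metric.mem_ball_self hr, hcs⟩ ⟨hcc' s hsI, hcs'⟩ hs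

variable [CompleteSpace F]

theorem eventuallyEq_of_isPreconnected (hI : IsPreconnected I) (hc : ContinuousOn c I)
    (hG : IsGermContinuation c I G) (hH : IsGermContinuation c I H) {x y : X} (hx : x ∈ I)
    (hy : y ∈ I) (h : G x =ᶠ[𝓝 (c x)] H x) : G y =ᶠ[𝓝 (c y)] H y := by
  refine hI.induction₂' (fun s t => G s =ᶠ[𝓝 (c s)] H s → G t =ᶠ[𝓝 (c t)] H t) (fun t ht => ?_)
    (fun _ _ _ _ _ _ h₁ h₂ => h₂ ∘ h₁) hx hy h
  obtain ⟨r, hr, hGr⟩ := (hG.analyticAt t ht).exists_ball_analyticOnNhd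
  obtain ⟨r', hr', hHr'⟩ := (hH.analyticAt t ht).exists_ball_analyticOnNhd
  filter_upwards [hG.eventually_eq t ht, hH.eventually_eq t ht,
    (hc t ht).eventually (Metric.ball_mem_nhds (c t) hr),
    (hc t ht).eventually (Metric.ball_mem_nhds (c t) hr')] with s hGs hHs hsr hsr'
  have hcenter : c t ∈ Metric.ball (c t) r ∩ Metric.ball (c t) r' :=
    ⟨Metric.mem_ball_self hr, Metric.mem_ball_self hr'⟩
  have hs : c s ∈ Metric.ball (c t) r ∩ Metric.ball (c t) r' := ⟨hsr, hsr'⟩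
  exact ⟨fun ht => (hGs.trans
      (eventuallyEq_of_analyticOnNhd_ball_inter hGr hHr' hcenter hs ht)).trans hHs.symm,
    fun hst => eventuallyEq_of_analyticOnNhd_ball_inter hGr hHr' hs hcenter
      ((hGs.symm.trans hst).trans hHs)⟩

theorem exists_uniform_radius (hI : IsCompact I) (hc : ContinuousOn c I)
    (h : IsGermContinuation c I G) :
    ∃ r > 0, ∃ H : X → E → F, IsGermContinuation c I H ∧
      (∀ t ∈ I, AnalyticOnNhd ℂ (H t) (Metric.ball (c t) r)) ∧
      ∀ t ∈ I, G t =ᶠ[𝓝 (c t)] H t := by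
  suffices hr : ∃ r > 0, ∀ t ∈ I, ∃ g : E → F, AnalyticOnNhd ℂ g (Metric.ball (c t) r) ∧
      G t =ᶠ[𝓝 (c t)] g by
    obtain ⟨r, hr, hG⟩ := hr
    choose! H hH hGH using hG
    exact ⟨r, hr, H, h.congr hc hGH, hH, hGH⟩
  refine hI.induction_on (p := fun K => ∃ r > 0, ∀ t ∈ K, ∃ g : E → F,
    AnalyticOnNhd ℂ g (Metric.ball (c t) r) ∧ G t =ᶠ[𝓝 (c t)] g) ⟨1, one_pos, by simp⟩ ?_ ?_ ?_
  · rintro K L hKL ⟨r, hr, hL⟩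
    exact ⟨r, hr, fun t ht => hL t (hKL ht)⟩
  · rintro K L ⟨r, hr, hK⟩ ⟨s, hs, hL⟩
    refine ⟨min r s, lt_min hr hs, fun t ht => ?_⟩
    rcases ht with ht | ht
    · obtain ⟨g, hg, hGg⟩ := hK t ht
      exact ⟨g, hg.mono (Metric.ball_subset_ball (min_le_left r s)), hGg⟩
    · obtain ⟨g, hg, hGg⟩ := hL t ht
      exact ⟨g, hg.mono (Metric.ball_subset_ball (min_le_right r s)), hGg⟩
  · intro t ht
    obtain ⟨r, hr, hGr⟩ := (h.analyticAt t ht).exists_ball_analyticOnNhd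
    refine ⟨_, (h.eventually_eq t ht).and
      ((hc t ht).eventually (Metric.ball_mem_nhds (c t) (half_pos hr))), r / 2, half_pos hr, ?_⟩
    rintro s ⟨hs, hsr : dist (c s) (c t) < r / 2⟩
    exact ⟨G t, hGr.mono (Metric.ball_subset_ball' (by linarith)), hs⟩

end IsGermContinuation

/-- The germ of `g` at `c a` can be continued analytically along the restriction of `c` to
`[a, b]`. -/
def GermContinuableAlong (g : E → F) (c : ℝ → E) (a b : ℝ) : Prop :=
  ∃ G : ℝ → E → F, IsGermContinuation c (Icc a b) G ∧ G a =ᶠ[𝓝 (c a)] g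

namespace GermContinuableAlong

variable {c : ℝ → E} {a b d : ℝ} {g : E → F}

theorem mono (h : GermContinuableAlong g c a b) (hd : d ≤ b) : GermContinuableAlong g c a d :=
  h.imp fun _ hG => ⟨hG.1.mono (Icc_subset_Icc_right hd), hG.2⟩

theorem comp {a' b' : ℝ} {c' : ℝ → E} {u : ℝ → ℝ} (h : GermContinuableAlong g c a b)
    (hu : ContinuousOn u (Icc a' b')) (hmaps : MapsTo u (Icc a' b') (Icc a b)) (ha : u a' = a)
    (hab' : a' ≤ b') (hc : EqOn (c ∘ u) c' (Icc a' b')) : GermContinuableAlong g c' a' b' := by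
  obtain ⟨G, hG, hGa⟩ := h
  refine ⟨G ∘ u, hG.comp hu hmaps hc, ?_⟩
  rwa [← hc (left_mem_Icc.2 hab'), Function.comp_apply, Function.comp_apply, ha]

theorem of_analyticAt (hg : ∀ t ∈ Icc a b, AnalyticAt ℂ g (c t)) : GermContinuableAlong g c a b :=
  ⟨fun _ => g, IsGermContinuation.const hg, EventuallyEq.rfl⟩

theorem of_eventually_min_max (hab : a ≤ b) (hg : AnalyticAt ℂ g (c a))
    (h : ∀ t ∈ Icc a b, ∀ᶠ s in 𝓝[Icc a b] t,
      GermContinuableAlong g c a (min t s) → GermContinuableAlong g c a (max t s)) :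
    GermContinuableAlong g c a b := by
  refine isPreconnected_Icc.induction₂'
    (fun s t => GermContinuableAlong g c a s → GermContinuableAlong g c a t) (fun t ht => ?_)
    (fun _ _ _ _ _ _ h₁ h₂ => h₂ ∘ h₁) (left_mem_Icc.2 hab) (right_mem_Icc.2 hab)
    (of_analyticAt fun t ht => ?_)
  · filter_upwards [h t ht] with s hs
    exact ⟨fun hc => (hs (hc.mono (min_le_left t s))).mono (le_max_right t s),
      fun hc => (hs (hc.mono (min_le_right t s))).mono (le_max_left t s)⟩
  · rwa [le_antisymm ht.2 ht.1]

theorem concat {G H : ℝ → E → F} (hc : ContinuousOn c (Icc b d)) (hab : a ≤ b) (hbd : b ≤ d)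
    (hG : IsGermContinuation c (Icc a b) G) (hGa : G a =ᶠ[𝓝 (c a)] g)
    (hH : IsGermContinuation c (Icc b d) H) (h : G b =ᶠ[𝓝 (c b)] H b) :
    GermContinuableAlong g c a d :=
  ⟨_, hG.concat hc hab hbd hH h, by simpa only [if_pos hab] using hGa⟩

variable [CompleteSpace F]

theorem tail (hc : ContinuousOn c (Icc a b)) (h : GermContinuableAlong g c a d) (hab : a ≤ b)
    (hbd : b ≤ d) {G : ℝ → E → F} (hG : IsGermContinuation c (Icc a b) G)
    (hGa : G a =ᶠ[𝓝 (c a)] g) : GermContinuableAlong (G b) c b d := by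
  obtain ⟨H, hH, hHa⟩ := h
  have hH' : IsGermContinuation c (Icc a b) H := hH.mono (Icc_subset_Icc_right hbd)
  exact ⟨H, hH.mono (Icc_subset_Icc_left hab), hH'.eventuallyEq_of_isPreconnected
    isPreconnected_Icc hc hG (left_mem_Icc.2 hab) (right_mem_Icc.2 hab) (hHa.trans hGa.symm)⟩

end GermContinuableAlong

theorem dist_lineMap_right_le {V : Type*} [NormedAddCommGroup V] [NormedSpace ℝ V] (p w z : V)
    {t : ℝ} (ht : t ∈ Icc (0 : ℝ) 1) :
    dist (AffineMap.lineMap p w t : V) (AffineMap.lineMap p z t) ≤ dist w z :=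
  calc dist (AffineMap.lineMap p w t : V) (AffineMap.lineMap p z t) = t * dist w z := by
        rw [AffineMap.lineMap_apply_module', AffineMap.lineMap_apply_module', dist_add_right,
          dist_smul₀, dist_sub_right, Real.norm_of_nonneg ht.1]
    _ ≤ dist w z := mul_le_of_le_one_left dist_nonneg ht.2

/- The extension sends `z` to the value at `z` of the continuation along the segment from `p` to
`z`; by stability under small perturbations of the path, it agrees near `z` with that
continuation. -/
theorem exists_analyticOnNhd_of_germContinuableAlong_lineMap [CompleteSpace F] {g : E → F} {p : E}
    {U : Set E} (hU : IsOpen U) (hp : p ∈ U)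
    (h : ∀ z ∈ U, GermContinuableAlong g (AffineMap.lineMap p z : ℝ → E) 0 1) :
    ∃ f, AnalyticOnNhd ℂ f U ∧ f =ᶠ[𝓝 p] g := by
  have hcont (z : E) : Continuous (AffineMap.lineMap p z : ℝ → E) := AffineMap.lineMap_continuous
  have h0 : (0 : ℝ) ∈ Icc (0 : ℝ) 1 := left_mem_Icc.2 zero_le_one
  have h1 : (1 : ℝ) ∈ Icc (0 : ℝ) 1 := right_mem_Icc.2 zero_le_one
  choose! G hG hGg using h
  simp only [AffineMap.lineMap_apply_zero] at hGg
  have hGz {z : E} (hz : z ∈ U) : AnalyticAt ℂ (G z 1) z := by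
    simpa only [AffineMap.lineMap_apply_one] using (hG z hz).analyticAt 1 h1
  have hlocal {z : E} (hz : z ∈ U) : (fun w => G w 1 w) =ᶠ[𝓝 z] G z 1 := by
    obtain ⟨r, hr, H, hH, hHr, hGH⟩ :=
      (hG z hz).exists_uniform_radius isCompact_Icc (hcont z).continuousOn
    have hGHz := hGH 1 h1
    rw [AffineMap.lineMap_apply_one] at hGHz
    filter_upwards [hU.mem_nhds hz, Metric.ball_mem_nhds z hr, hGHz] with w hwU hwz hGHw
    have hHw := hH.of_dist_lt (hcont z).continuousOn (hcont w).continuousOn hHr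
      fun t ht => (dist_lineMap_right_le p w z ht).trans_lt hwz
    have hstart : G w 0 =ᶠ[𝓝 (AffineMap.lineMap p w (0 : ℝ))] H 0 := by
      have := hGH 0 h0
      rw [AffineMap.lineMap_apply_zero] at this ⊢
      exact ((hGg w hwU).trans (hGg z hz).symm).trans this
    have hend := (hG w hwU).eventuallyEq_of_isPreconnected isPreconnected_Icc
      (hcont w).continuousOn hHw h0 h1 hstart
    rw [AffineMap.lineMap_apply_one] at hend
    exact hend.self_of_nhds.trans hGHw.symm
  refine ⟨fun z => G z 1 z, fun z hz => (hGz hz).congr (hlocal hz).symm, (hlocal hp).trans ?_⟩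
  have hconst : IsGermContinuation (AffineMap.lineMap p p : ℝ → E) (Icc 0 1) fun _ => G p 1 :=
    .const fun t _ => by simpa using hGz hp
  have := hconst.eventuallyEq_of_isPreconnected isPreconnected_Icc (hcont p).continuousOn
    (hG p hp) h1 h0 EventuallyEq.rfl
  rw [AffineMap.lineMap_apply_zero] at this
  exact this.trans (hGg p hp)

end GermContinuation

section Variation

variable {α E : Type*} [LinearOrder α] [SeminormedAddCommGroup E]

theorem eVariationOn_add_le (f g : α → E) (s : Set α) :
    eVariationOn (f + g) s ≤ eVariationOn f s + eVariationOn g s := by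
  refine iSup_le fun p => ?_
  calc ∑ i ∈ Finset.range p.1, edist ((f + g) (p.2.1 (i + 1))) ((f + g) (p.2.1 i))
      ≤ ∑ i ∈ Finset.range p.1, (edist (f (p.2.1 (i + 1))) (f (p.2.1 i)) +
          edist (g (p.2.1 (i + 1))) (g (p.2.1 i))) :=
        Finset.sum_le_sum fun i _ => edist_add_add_le _ _ _ _
    _ ≤ eVariationOn f s + eVariationOn g s := by
        rw [Finset.sum_add_distrib]
        exact add_le_add (eVariationOn.sum_le p.2.2.1 p.2.2.2)
          (eVariationOn.sum_le p.2.2.1 p.2.2.2)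

theorem eVariationOn_Icc_le_of_lipschitzOnWith {X : Type*} [PseudoEMetricSpace X] {f : ℝ → X}
    {K : ℝ≥0} {a b : ℝ} (hf : LipschitzOnWith K f (Icc a b)) :
    eVariationOn f (Icc a b) ≤ K * ENNReal.ofReal (b - a) :=
  eVariationOn_id_Icc a b ▸ hf.comp_eVariationOn_le (mapsTo_id _)

theorem lipschitzWith_smul_const {V : Type*} [NormedAddCommGroup V] [NormedSpace ℝ V] (v : V) :
    LipschitzWith ‖v‖₊ fun t : ℝ => t • v :=
  LipschitzWith.of_dist_le_mul fun s t => by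
    rw [dist_eq_norm, dist_eq_norm, ← sub_smul, norm_smul, mul_comm, coe_nnnorm]

end Variation

section Drift

variable {E : Type*} [NormedAddCommGroup E] [NormedSpace ℝ E] [FiniteDimensional ℝ E]

/- A point `σ` is met at time `t` exactly for `w = t⁻¹ • (σ - c t)`; as `t` varies, these `w` form a
locally Lipschitz curve, hence a set of Hausdorff dimension at most one. -/
theorem dense_setOf_add_smul_notMem {S : Set E} {c : ℝ → E} {I : Set ℝ} {K : ℝ≥0}
    (hE : 1 < Module.finrank ℝ E) (hS : S.Countable) (hI : I ⊆ Ioi 0) (hc : LipschitzOnWith K c I) :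
    Dense {w : E | ∀ t ∈ I, c t + t • w ∉ S} := by
  let B (σ : E) : Set E :=
    (fun p : ℝ × E => p.1⁻¹ • (σ - p.2)) '' ((fun t => (t, c t)) '' I)
  have hB (σ : E) : dimH (B σ) ≤ 1 := by
    have hsmooth : ContDiffOn ℝ 1 (fun p : ℝ × E => p.1⁻¹ • (σ - p.2)) (Ioi 0 ×ˢ univ) :=
      (contDiffOn_fst.inv fun p hp => (ne_of_gt hp.1)).smul (contDiffOn_const.sub contDiffOn_snd)
    have hgraph : (fun t => (t, c t)) '' I ⊆ Ioi 0 ×ˢ univ :=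
      image_subset_iff.2 fun t ht => ⟨hI ht, mem_univ _⟩
    calc dimH (B σ) ≤ dimH ((fun t => (t, c t)) '' I) :=
          hsmooth.dimH_image_le ((convex_Ioi 0).prod convex_univ) hgraph
      _ ≤ dimH I := (LipschitzWith.id.lipschitzOnWith.prodMk hc).dimH_image_le
      _ ≤ 1 := (dimH_mono (subset_univ _)).trans_eq Real.dimH_univ
  have hdense : Dense (⋃ σ ∈ S, B σ)ᶜ := by
    refine dense_compl_of_dimH_lt_finrank ?_
    rw [dimH_bUnion hS]
    exact (iSup₂_le fun σ _ => hB σ).trans_lt (by exact_mod_cast hE)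
  refine hdense.mono fun w (hw : w ∉ ⋃ σ ∈ S, B σ) t ht hmem => hw ?_
  refine mem_biUnion hmem ⟨_, mem_image_of_mem _ ht, ?_⟩
  simp only [add_sub_cancel_left, inv_smul_smul₀ (mem_Ioi.1 (hI ht)).ne']

end Drift

namespace LipPath

variable (γ : LipPath)

theorem continuousOn : ContinuousOn γ.toFun (Icc 0 γ.T) :=
  let ⟨_, hK⟩ := γ.lipschitz
  hK.continuousOn

theorem coe_lengthUpTo {t : ℝ} (ht : t ≤ γ.T) :
    (γ.lengthUpTo t : ℝ≥0∞) = eVariationOn γ.toFun (Icc 0 t) := by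
  obtain ⟨K, hK⟩ := γ.lipschitz
  have h := eVariationOn_Icc_le_of_lipschitzOnWith (hK.mono (Icc_subset_Icc_right ht))
  exact ENNReal.coe_toNNReal (h.trans_lt (by finiteness)).ne

theorem coe_length : (γ.length : ℝ≥0∞) = eVariationOn γ.toFun (Icc 0 γ.T) :=
  γ.coe_lengthUpTo le_rfl

theorem lengthUpTo_zero : γ.lengthUpTo 0 = 0 := by
  simp only [lengthUpTo, Icc_self, eVariationOn.subsingleton _ subsingleton_singleton,
    ENNReal.toNNReal_zero]

theorem lengthUpTo_mono {s t : ℝ} (hst : s ≤ t) (ht : t ≤ γ.T) :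
    γ.lengthUpTo s ≤ γ.lengthUpTo t := by
  rw [← ENNReal.coe_le_coe, γ.coe_lengthUpTo (hst.trans ht), γ.coe_lengthUpTo ht]
  exact eVariationOn.mono _ (Icc_subset_Icc_right hst)

theorem norm_le_lengthUpTo {t : ℝ} (ht : t ∈ Icc 0 γ.T) : ‖γ.toFun t‖ ≤ γ.lengthUpTo t := by
  have h := eVariationOn.edist_le γ.toFun (right_mem_Icc.2 ht.1) (left_mem_Icc.2 ht.1)
  rw [← γ.coe_lengthUpTo ht.2, γ.map_zero, edist_zero_right, enorm_eq_nnnorm] at h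
  exact_mod_cast h

/-- The restriction of `γ` to `[0, s]`. -/
def truncate {s : ℝ} (hs : s ∈ Icc 0 γ.T) : LipPath where
  T := s
  T_nonneg := hs.1
  toFun := γ.toFun
  lipschitz := γ.lipschitz.imp fun _ hK => hK.mono (Icc_subset_Icc_right hs.2)
  map_zero := γ.map_zero

/-- The path `γ` with a constant velocity `w` added; it is used to push `γ` off a finite set. -/
noncomputable def drift (w : ℂ) : LipPath where
  T := γ.T
  T_nonneg := γ.T_nonneg
  toFun t := γ.toFun t + t • w
  lipschitz := by
    obtain ⟨K, hK⟩ := γ.lipschitz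
    exact ⟨_, hK.add (lipschitzWith_smul_const w).lipschitzOnWith⟩
  map_zero := by rw [γ.map_zero, zero_smul, add_zero]

/-- The path `γ` followed by the straight segment from its end point to `z`. -/
noncomputable def snoc (z : ℂ) : LipPath where
  T := γ.T + 1
  T_nonneg := add_nonneg γ.T_nonneg zero_le_one
  toFun t := γ.toFun (min t γ.T) + (max t γ.T - γ.T) • (z - γ.toFun γ.T)
  lipschitz := by
    obtain ⟨K, hK⟩ := γ.lipschitz
    have hmin : LipschitzWith 1 fun t => min t γ.T := LipschitzWith.id.min_const γ.T
    have hmax : LipschitzWith 1 fun t => max t γ.T := LipschitzWith.id.max_const γ.T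
    have hmaps : MapsTo (fun t => min t γ.T) (Icc 0 (γ.T + 1)) (Icc 0 γ.T) := fun t ht =>
      ⟨le_min ht.1 γ.T_nonneg, min_le_right t γ.T⟩
    exact ⟨_, (hK.comp hmin.lipschitzOnWith hmaps).add ((lipschitzWith_smul_const _).comp
      (hmax.sub (LipschitzWith.const γ.T))).lipschitzOnWith⟩
  map_zero := by
    rw [min_eq_left γ.T_nonneg, max_eq_right γ.T_nonneg, γ.map_zero, sub_self, zero_smul, add_zero]

theorem mapsTo_mul_T : MapsTo (fun t => t * γ.T) (Icc 0 1) (Icc 0 γ.T) := fun _ ht =>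
  ⟨mul_nonneg ht.1 γ.T_nonneg, mul_le_of_le_one_left γ.T_nonneg ht.2⟩

/-- The path `γ` reparametrized by `[0, 1]`. -/
def rescale : LipPath where
  T := 1
  T_nonneg := zero_le_one
  toFun t := γ.toFun (t * γ.T)
  lipschitz := by
    obtain ⟨K, hK⟩ := γ.lipschitz
    exact ⟨_, hK.comp (lipschitzWith_smul_const γ.T).lipschitzOnWith γ.mapsTo_mul_T⟩
  map_zero := by rw [zero_mul, γ.map_zero]

theorem length_rescale_le : γ.rescale.length ≤ γ.length := by
  rw [← ENNReal.coe_le_coe, coe_length, coe_length]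
  exact eVariationOn.comp_le_of_monotoneOn γ.toFun _
    (fun s _ t _ hst => mul_le_mul_of_nonneg_right hst γ.T_nonneg) γ.mapsTo_mul_T

theorem length_drift_le (w : ℂ) : ((γ.drift w).length : ℝ) ≤ γ.length + ‖γ.T • w‖ := by
  have h : eVariationOn (γ.drift w).toFun (Icc 0 γ.T) ≤ γ.length + ‖γ.T • w‖ₑ := by
    calc eVariationOn (γ.drift w).toFun (Icc 0 γ.T)
        ≤ eVariationOn γ.toFun (Icc 0 γ.T) + eVariationOn (fun t : ℝ => t • w) (Icc 0 γ.T) :=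
          eVariationOn_add_le γ.toFun (fun t : ℝ => t • w) _
      _ ≤ γ.length + ‖w‖ₑ * ENNReal.ofReal (γ.T - 0) :=
          add_le_add γ.coe_length.ge (eVariationOn_Icc_le_of_lipschitzOnWith
            (lipschitzWith_smul_const w).lipschitzOnWith)
      _ = γ.length + ‖γ.T • w‖ₑ := by
          rw [enorm_smul, Real.enorm_of_nonneg γ.T_nonneg, sub_zero, mul_comm]
  have h' : ((γ.drift w).length : ℝ≥0∞) ≤ γ.length + ‖γ.T • w‖ₑ := (γ.drift w).coe_length.trans_le h
  rw [enorm_eq_nnnorm] at h'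
  exact_mod_cast h'

variable {γ}

theorem snoc_of_le (z : ℂ) {t : ℝ} (ht : t ≤ γ.T) : (γ.snoc z).toFun t = γ.toFun t := by
  simp only [snoc, min_eq_left ht, max_eq_right ht, sub_self, zero_smul, add_zero]

theorem snoc_of_ge (z : ℂ) {t : ℝ} (ht : γ.T ≤ t) :
    (γ.snoc z).toFun t = AffineMap.lineMap (γ.toFun γ.T) z (t - γ.T) := by
  simp only [snoc, min_eq_right ht, max_eq_left ht, AffineMap.lineMap_apply_module', add_comm]

theorem length_snoc_le (z : ℂ) :
    ((γ.snoc z).length : ℝ) ≤ γ.length + dist (γ.toFun γ.T) z := by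
  have hT : γ.T ≤ γ.T + 1 := (lt_add_one γ.T).le
  have hseg : LipschitzOnWith (nndist (γ.toFun γ.T) z) (γ.snoc z).toFun (Icc γ.T (γ.T + 1)) := by
    intro s hs t ht
    rw [snoc_of_ge z hs.1, snoc_of_ge z ht.1, ← edist_sub_right s t γ.T]
    exact lipschitzWith_lineMap (γ.toFun γ.T) z (s - γ.T) (t - γ.T)
  have h : ((γ.snoc z).length : ℝ≥0∞) ≤ γ.length + nndist (γ.toFun γ.T) z := by
    calc ((γ.snoc z).length : ℝ≥0∞)
        = eVariationOn (γ.snoc z).toFun (Icc 0 γ.T) +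
            eVariationOn (γ.snoc z).toFun (Icc γ.T (γ.T + 1)) := by
          have := eVariationOn.Icc_add_Icc (γ.snoc z).toFun γ.T_nonneg hT (mem_univ γ.T)
          simp only [univ_inter] at this
          exact (γ.snoc z).coe_length.trans this.symm
      _ ≤ γ.length + nndist (γ.toFun γ.T) z * ENNReal.ofReal (γ.T + 1 - γ.T) := by
          rw [eVariationOn.congr fun t ht => snoc_of_le z ht.2, γ.coe_length]
          gcongr
          exact eVariationOn_Icc_le_of_lipschitzOnWith hseg
      _ = γ.length + nndist (γ.toFun γ.T) z := by
          rw [add_sub_cancel_left, ENNReal.ofReal_one, mul_one]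
  exact_mod_cast h

theorem snoc_notMem {S : Set ℂ} {z : ℂ} (h : ∀ t ∈ Ioc 0 γ.T, γ.toFun t ∉ S)
    (hz : ∀ t ∈ Icc (0 : ℝ) 1, (AffineMap.lineMap (γ.toFun γ.T) z t : ℂ) ∉ S) :
    ∀ t ∈ Ioc 0 (γ.snoc z).T, (γ.snoc z).toFun t ∉ S := by
  rintro t ⟨ht0, ht1 : t ≤ γ.T + 1⟩
  rcases le_total t γ.T with htT | htT
  · exact snoc_of_le z htT ▸ h t ⟨ht0, htT⟩
  · exact snoc_of_ge z htT ▸ hz _ ⟨sub_nonneg.2 htT, by linarith⟩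

theorem exists_drift_notMem (γ : LipPath) {S : Set ℂ} (hS : S.Countable) {ε : ℝ} (hε : 0 < ε) :
    ∃ w : ℂ, ‖γ.T • w‖ < ε ∧ ∀ t ∈ Ioc 0 γ.T, (γ.drift w).toFun t ∉ S := by
  obtain ⟨K, hK⟩ := γ.lipschitz
  have hdense := dense_setOf_add_smul_notMem (by rw [Complex.finrank_real_complex]; norm_num) hS
    Ioc_subset_Ioi_self (hK.mono Ioc_subset_Icc_self)
  have hopen : IsOpen {w : ℂ | ‖γ.T • w‖ < ε} :=
    isOpen_lt (continuous_const_smul γ.T).norm continuous_const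
  have h0 : ‖γ.T • (0 : ℂ)‖ < ε := by rwa [smul_zero, norm_zero]
  exact hdense.inter_open_nonempty _ hopen ⟨0, h0⟩

end LipPath

theorem eventually_mapsTo_uIcc {X : Type*} [TopologicalSpace X] {c : ℝ → X} {a b t : ℝ}
    (hc : ContinuousWithinAt c (Icc a b) t) (ht : t ∈ Icc a b) {U : Set X} (hU : U ∈ 𝓝 (c t)) :
    ∀ᶠ y in 𝓝[Icc a b] t, MapsTo c (uIcc t y) U :=
  tendsto_smallSets_iff.1 ((tendsto_const_nhdsWithin ht).uIcc tendsto_id) _ (hc hU)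

theorem analyticAt_evalSum {φ : ℂ⟦X⟧} (hφ : IsConvergent φ) : AnalyticAt ℂ (evalSum φ) 0 :=
  ((toFMS φ).hasFPowerSeriesOnBall hφ).analyticAt

variable {φ : ℂ⟦X⟧} {γ : LipPath} {S : Set ℂ} {N : ℝ}

theorem continuableAlong_iff_germContinuableAlong :
    ContinuableAlong φ γ ↔ GermContinuableAlong (evalSum φ) γ.toFun 0 γ.T := by
  refine exists_congr fun F => ?_
  rw [γ.map_zero]
  exact ⟨fun ⟨h, h0, he⟩ => ⟨⟨h, he⟩, h0⟩, fun ⟨⟨h, he⟩, h0⟩ => ⟨h, h0, he⟩⟩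

/-- `φ` can be continued along every path of length `< N` that avoids `S` after its starting point,
whatever the parameter interval. -/
def ContinuableAvoiding (φ : ℂ⟦X⟧) (S : Set ℂ) (N : ℝ) : Prop :=
  ∀ γ : LipPath, 0 < γ.T → (γ.length : ℝ) < N → (∀ t ∈ Ioc 0 γ.T, γ.toFun t ∉ S) →
    ContinuableAlong φ γ

namespace ContinuableAvoiding

theorem of_unitInterval (h : ∀ γ : LipPath, γ.T = 1 → (γ.length : ℝ) < N →
    (∀ t ∈ Ioc (0 : ℝ) 1, γ.toFun t ∉ S) → ContinuableAlong φ γ) : ContinuableAvoiding φ S N := by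
  intro γ hT hlen hS
  have hlen' : (γ.rescale.length : ℝ) < N := lt_of_le_of_lt (mod_cast γ.length_rescale_le) hlen
  have hrescale := continuableAlong_iff_germContinuableAlong.1 (h γ.rescale rfl hlen' fun t ht =>
    hS _ ⟨mul_pos ht.1 hT, mul_le_of_le_one_left hT.le ht.2⟩)
  have hmaps : MapsTo (fun t => t / γ.T) (Icc 0 γ.T) (Icc 0 1) := fun t ht =>
    ⟨div_nonneg ht.1 hT.le, div_le_one_of_le₀ ht.2 hT.le⟩
  refine continuableAlong_iff_germContinuableAlong.2 (hrescale.comp (by fun_prop) hmaps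
    (zero_div _) hT.le fun t _ => ?_)
  simp only [Function.comp_apply, LipPath.rescale, div_mul_cancel₀ t hT.ne']

theorem exists_analyticOnNhd_of_notMem (h : ContinuableAvoiding φ S N)
    (hγS : ∀ t ∈ Ioc 0 γ.T, γ.toFun t ∉ S) {F : ℝ → ℂ → ℂ}
    (hF : IsGermContinuation γ.toFun (Icc 0 γ.T) F) (hF0 : F 0 =ᶠ[𝓝 0] evalSum φ) {U : Set ℂ}
    (hU : IsOpen U) (hUc : Convex ℝ U) (hUS : Disjoint U S) (hγU : γ.toFun γ.T ∈ U)
    (hlen : ∀ z ∈ U, γ.length + dist (γ.toFun γ.T) z < N) :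
    ∃ g, AnalyticOnNhd ℂ g U ∧ g =ᶠ[𝓝 (γ.toFun γ.T)] F γ.T := by
  refine exists_analyticOnNhd_of_germContinuableAlong_lineMap hU hγU fun z hz => ?_
  have hT : γ.T ≤ (γ.snoc z).T := (lt_add_one γ.T).le
  have hsnocS := LipPath.snoc_notMem (z := z) hγS fun t ht =>
    hUS.notMem_of_mem_left (hUc.lineMap_mem hγU hz ht)
  have hsnoc := continuableAlong_iff_germContinuableAlong.1 (h (γ.snoc z)
    (add_pos_of_nonneg_of_pos γ.T_nonneg one_pos)
    ((LipPath.length_snoc_le z).trans_lt (hlen z hz)) hsnocS)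
  have hF' : IsGermContinuation (γ.snoc z).toFun (Icc 0 γ.T) F :=
    hF.congr_path fun t ht => (LipPath.snoc_of_le z ht.2).symm
  have htail := hsnoc.tail ((γ.snoc z).continuousOn.mono (Icc_subset_Icc_right hT)) γ.T_nonneg hT
    hF' ((γ.snoc z).map_zero.symm ▸ hF0)
  have hmaps : MapsTo (fun t => γ.T + t) (Icc 0 1) (Icc γ.T (γ.snoc z).T) := fun t ht =>
    ⟨le_add_of_nonneg_right ht.1, add_le_add_right ht.2 γ.T⟩
  refine htail.comp (by fun_prop) hmaps (add_zero _) zero_le_one fun t ht => ?_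
  rw [Function.comp_apply, LipPath.snoc_of_ge z (hmaps ht).1, add_sub_cancel_left]

/- `γ` itself may meet `S`, but its germs are carried over to `γ.drift w` for small `w`, and this
path avoids `S` for a suitable `w`. -/
theorem exists_analyticOnNhd_ball (h : ContinuableAvoiding φ S N) (hS : S.Countable)
    {F : ℝ → ℂ → ℂ} (hF : IsGermContinuation γ.toFun (Icc 0 γ.T) F) (hF0 : F 0 =ᶠ[𝓝 0] evalSum φ)
    {R : ℝ} (hR : 0 < R) (hRS : Disjoint (Metric.ball (γ.toFun γ.T) R) S)
    (hlen : γ.length + R < N) :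
    ∃ g, AnalyticOnNhd ℂ g (Metric.ball (γ.toFun γ.T) R) ∧ g =ᶠ[𝓝 (γ.toFun γ.T)] F γ.T := by
  obtain ⟨r, hr, H, hH, hHr, hFH⟩ := hF.exists_uniform_radius isCompact_Icc γ.continuousOn
  have hη : 0 < (N - γ.length - R) / 2 := by linarith
  obtain ⟨w, hw, hwS⟩ := γ.exists_drift_notMem hS (lt_min hr (lt_min hR hη))
  obtain ⟨hwr, hwR, hwη⟩ : ‖γ.T • w‖ < r ∧ ‖γ.T • w‖ < R ∧ ‖γ.T • w‖ < (N - γ.length - R) / 2 := by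
    simpa only [lt_min_iff] using hw
  have hdist (t : ℝ) : dist ((γ.drift w).toFun t) (γ.toFun t) = ‖t • w‖ := by
    rw [dist_eq_norm, LipPath.drift, add_sub_cancel_left]
  have h0 : (0 : ℝ) ∈ Icc 0 γ.T := left_mem_Icc.2 γ.T_nonneg
  have hT : γ.T ∈ Icc 0 γ.T := right_mem_Icc.2 γ.T_nonneg
  have hHw : IsGermContinuation (γ.drift w).toFun (Icc 0 γ.T) H := by
    refine hH.of_dist_lt γ.continuousOn (γ.drift w).continuousOn hHr fun t ht => ?_
    calc dist ((γ.drift w).toFun t) (γ.toFun t) = |t| * ‖w‖ := by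
          rw [hdist, norm_smul, Real.norm_eq_abs]
      _ ≤ |γ.T| * ‖w‖ := by gcongr; exacts [ht.1, ht.2]
      _ < r := by rwa [norm_smul, Real.norm_eq_abs] at hwr
  have hH0 : H 0 =ᶠ[𝓝 0] evalSum φ := (γ.map_zero ▸ hFH 0 h0).symm.trans hF0
  have hwT : (γ.drift w).toFun γ.T ∈ Metric.ball (γ.toFun γ.T) R := (hdist γ.T).trans_lt hwR
  have hlen' : ∀ z ∈ Metric.ball (γ.toFun γ.T) R,
      (γ.drift w).length + dist ((γ.drift w).toFun γ.T) z < N := fun z hz => by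
    have := dist_triangle_right ((γ.drift w).toFun γ.T) z (γ.toFun γ.T)
    linarith [γ.length_drift_le w, hdist γ.T, Metric.mem_ball.1 hz]
  obtain ⟨g, hg, hgH⟩ := h.exists_analyticOnNhd_of_notMem hwS hHw hH0 Metric.isOpen_ball
    (convex_ball _ _) hRS hwT hlen'
  exact ⟨g, hg, (eventuallyEq_of_analyticOnNhd_ball_inter hg (hHr γ.T hT)
    ⟨hwT, (hdist γ.T).trans_lt hwr⟩ ⟨Metric.mem_ball_self hR, Metric.mem_ball_self hr⟩
    hgH).trans (hFH γ.T hT).symm⟩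

theorem eventually_germContinuableAlong_max (h : ContinuableAvoiding φ S N) (hS : S.Finite) {t : ℝ}
    (ht : t ∈ Icc 0 γ.T) (htS : γ.toFun t ∉ S) (hlen : γ.lengthUpTo t < N) :
    ∀ᶠ y in 𝓝[Icc 0 γ.T] t, GermContinuableAlong (evalSum φ) γ.toFun 0 (min t y) →
      GermContinuableAlong (evalSum φ) γ.toFun 0 (max t y) := by
  obtain ⟨ρ, hρ, hρS⟩ := Metric.isOpen_iff.1 hS.isClosed.isOpen_compl _ htS
  obtain ⟨R, hR, hRlt⟩ : ∃ R > 0, R < min (ρ / 2) (N - γ.lengthUpTo t) :=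
    exists_between (lt_min (half_pos hρ) (sub_pos.2 hlen))
  obtain ⟨hRρ, hRN⟩ := lt_min_iff.1 hRlt
  filter_upwards [self_mem_nhdsWithin, eventually_mapsTo_uIcc (γ.continuousOn t ht) ht
    (Metric.ball_mem_nhds (γ.toFun t) (half_pos hR))] with y hy hnear
  rintro ⟨F, hF, hF0⟩
  have hs : min t y ∈ Icc 0 γ.T := ⟨le_min ht.1 hy.1, min_le_of_left_le ht.2⟩
  have hsR : dist (γ.toFun (min t y)) (γ.toFun t) < R / 2 := hnear ⟨le_rfl, min_le_max⟩
  have hball : Disjoint (Metric.ball (γ.toFun (min t y)) R) S :=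
    (subset_compl_iff_disjoint_right.1 hρS).mono_left (Metric.ball_subset_ball' (by linarith))
  have hlens : γ.lengthUpTo (min t y) ≤ γ.lengthUpTo t := γ.lengthUpTo_mono (min_le_left t y) ht.2
  obtain ⟨g, hg, hgF⟩ := h.exists_analyticOnNhd_ball (γ := γ.truncate hs) hS.countable hF
    (γ.map_zero ▸ hF0) hR hball (lt_sub_iff_add_lt'.1 (hRN.trans_le
      (sub_le_sub_left (mod_cast hlens) N)))
  refine GermContinuableAlong.concat (γ.continuousOn.mono ?_) hs.1 min_le_max hF hF0 (.const
    fun x hx => hg _ ?_) hgF.symm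
  · exact Icc_subset_Icc hs.1 (max_le ht.2 hy.2)
  · have hx : dist (γ.toFun x) (γ.toFun t) < R / 2 := hnear hx
    exact (dist_triangle_right _ _ (γ.toFun t)).trans_lt
      ((add_lt_add hx hsR).trans_eq (add_halves R))

end ContinuableAvoiding

theorem eventually_germContinuableAlong_of_lengthUpTo_lt {δ : ℝ}
    (hφ : AnalyticOnNhd ℂ (evalSum φ) (Metric.ball 0 δ)) {t : ℝ} (ht : t ∈ Icc 0 γ.T)
    (hlen : γ.lengthUpTo t < δ) :
    ∀ᶠ y in 𝓝[Icc 0 γ.T] t, GermContinuableAlong (evalSum φ) γ.toFun 0 (max t y) := by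
  have hball {x : ℝ} (hx : x ∈ Icc 0 t) : γ.toFun x ∈ Metric.ball 0 δ := by
    rw [mem_ball_zero_iff]
    calc ‖γ.toFun x‖ ≤ γ.lengthUpTo x := γ.norm_le_lengthUpTo ⟨hx.1, hx.2.trans ht.2⟩
      _ ≤ γ.lengthUpTo t := mod_cast γ.lengthUpTo_mono hx.2 ht.2
      _ < δ := hlen
  filter_upwards [eventually_mapsTo_uIcc (γ.continuousOn t ht) ht
    (Metric.isOpen_ball.mem_nhds (hball (right_mem_Icc.2 ht.1)))] with y hy
  refine .of_analyticAt fun x hx => hφ _ ?_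
  rcases le_total x t with hxt | hxt
  · exact hball ⟨hx.1, hxt⟩
  · exact hy ⟨inf_le_left.trans hxt, hx.2⟩

theorem DiscreteFilteredSet.mem_of_mem_closure_graph (Ω : DiscreteFilteredSet) {l L : ℝ≥0} {w : ℂ}
    (hl : l < L) (h : (l, w) ∈ closure Ω.graph) : w ∈ Ω.carrier L := by
  by_contra hw
  have hU : Iio L ×ˢ (Ω.carrier L)ᶜ ∈ 𝓝 (l, w) :=
    prod_mem_nhds (Iio_mem_nhds hl) ((Ω.finite L).isClosed.isOpen_compl.mem_nhds hw)
  obtain ⟨⟨l', w'⟩, ⟨hl', hw'⟩, hmem⟩ := mem_closure_iff_nhds.1 h _ hU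
  exact hw' (Ω.mono l' L (le_of_lt hl') hmem)

theorem continuable_subset_endlesslyContinuable (Ω : DiscreteFilteredSet) :
    Continuable Ω ⊆ EndlesslyContinuable := by
  rintro φ ⟨hφ, h⟩
  refine ⟨hφ, fun L _ => ⟨Ω.carrier L.toNNReal, Ω.finite _, fun γ hT hlen hav => h γ ?_⟩⟩
  intro t ht hmem
  rcases ht.1.eq_or_lt with rfl | h0
  · obtain ⟨δ, hδ, hempty⟩ := Ω.exists_empty
    rw [γ.lengthUpTo_zero] at hmem
    exact notMem_empty _ (hempty ▸ Ω.mem_of_mem_closure_graph hδ hmem)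
  · have hlt : γ.lengthUpTo t < L.toNNReal :=
      (γ.lengthUpTo_mono ht.2 le_rfl).trans_lt (Real.lt_toNNReal_iff_coe_lt.2 hlen)
    exact hav t ⟨h0, hT ▸ ht.2⟩ (Ω.mem_of_mem_closure_graph hlt hmem)

/-- The discrete filtered set `Ω_L = S 0 ∪ ⋯ ∪ S ⌊L⌋` for `L ≥ δ`, and `Ω_L = ∅` for `L < δ`. -/
def DiscreteFilteredSet.ofSeq (δ : ℝ≥0) (hδ : 0 < δ) (S : ℕ → Set ℂ) (hS : ∀ k, (S k).Finite) :
    DiscreteFilteredSet where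
  carrier L := {w | δ ≤ L ∧ ∃ k ≤ ⌊L⌋₊, w ∈ S k}
  finite L := by
    refine ((finite_Iic ⌊L⌋₊).biUnion fun k _ => hS k).subset ?_
    rintro w ⟨-, k, hk, hw⟩
    exact mem_biUnion hk hw
  mono L₁ L₂ h := by
    rintro w ⟨hδL, k, hk, hw⟩
    exact ⟨hδL.trans h, k, hk.trans (Nat.floor_mono h), hw⟩
  exists_empty := ⟨δ / 2, half_pos hδ,
    eq_empty_of_forall_notMem fun _ hw => (half_lt_self hδ).not_ge hw.1⟩

theorem exists_mem_continuable (h : φ ∈ EndlesslyContinuable) :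
    ∃ Ω : DiscreteFilteredSet, φ ∈ Continuable Ω := by
  obtain ⟨hφ, h⟩ := h
  obtain ⟨δ, hδ, hφδ⟩ := (analyticAt_evalSum hφ).exists_ball_analyticOnNhd
  lift δ to ℝ≥0 using hδ.le
  choose S hSfin hS using fun k : ℕ => h (k + 1) k.cast_add_one_pos
  refine ⟨.ofSeq δ (mod_cast hδ) S hSfin, hφ, fun γ hγ =>
    continuableAlong_iff_germContinuableAlong.2 (.of_eventually_min_max γ.T_nonneg
      (γ.map_zero ▸ analyticAt_evalSum hφ) fun t ht => ?_)⟩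
  rcases lt_or_ge (γ.lengthUpTo t) δ with hlt | hge
  · filter_upwards [eventually_germContinuableAlong_of_lengthUpTo_lt hφδ ht (mod_cast hlt)]
      with y hy _ using hy
  · have htS : γ.toFun t ∉ S ⌊γ.lengthUpTo t⌋₊ := fun hmem =>
      hγ t ht (subset_closure ⟨hge, _, le_rfl, hmem⟩)
    exact (ContinuableAvoiding.of_unitInterval (hS _)).eventually_germContinuableAlong_max
      (hSfin _) ht htS (mod_cast Nat.lt_floor_add_one (γ.lengthUpTo t))

theorem endlesslyContinuable_eq_iUnion : EndlesslyContinuable = ⋃ Ω, Continuable Ω :=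
  subset_antisymm (fun _ hφ => mem_iUnion.2 (exists_mem_continuable hφ))
    (iUnion_subset continuable_subset_endlesslyContinuable)

end Resurgence

theorem proposition1 :
    (∀ φ : PowerSeries ℂ,
      φ ∈ Resurgence.Resurgent ↔
        ∃ Ω : Resurgence.DiscreteFilteredSet, φ ∈ Resurgence.ResurgentFor Ω) ∧
    Resurgence.EndlesslyContinuable =
      ⋃ Ω : Resurgence.DiscreteFilteredSet, Resurgence.Continuable Ω := by
  refine ⟨fun φ => ?_, Resurgence.endlesslyContinuable_eq_iUnion⟩
  simp only [Resurgence.Resurgent, Resurgence.ResurgentFor, mem_preimage, mem_prod, mem_univ,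
    true_and, Resurgence.endlesslyContinuable_eq_iUnion, mem_iUnion]
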